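/- All spaces are real. The norm of a normed space $X$ is called octahedral if for every finite-dimensional subspace $E$ of $X$ and every $\varepsilon>0$ there is $y\in X$ with $\|y\|=1$ such that $\|x+\lambda y\|\ge(1-\varepsilon)(\|x\|+|\lambda|)$ for all $x\in E$ and all $\lambda\in\mathbb R$. Let $L(X,Y)$ denote the space of bounded linear operators from $X$ to $Y$ with the operator norm, and let $L_1=L_1[0,1]$ with respect to Lebesgue measure. Let $2\le p<\infty$, and let $p^*$ be the conjugate exponent, $\frac1p+\frac1{p^*}=1$. For a Banach space $Y$, regard the algebraic tensor product $\ell_p\otimes Y$ as the subspace of $L(\ell_{p^*},Y)$ spanned by the operators $a\otimes y\colon x\mapsto\bigl(\sum_n a_nx_n\bigr)y$ with $a\in\ell_p$, $y\in Y$. Then: 1. If $H$ is a closed subspace of $L(\ell_{p^*},\ell_1)$ containing $\ell_p\otimes\ell_1$, then the norm of $H$ (the restriction of the operator norm) is octahedral. 2. If $H$ is a closed subspace of $L(\ell_{p^*},L_1)$ containing $\ell_p\otimes L_1$, then the norm of $H$ is octahedral. -/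

import Mathlib

open scoped ENNReal

/-- The norm of the real normed space `X` is octahedral: for every finite-dimensional subspace `E`
and every `ε > 0` there is a unit vector `y` of `X` such that
`‖x + c • y‖ ≥ (1 - ε) * (‖x‖ + |c|)` for all `x ∈ E` and all real `c`. -/
def HasOctahedralNorm (X : Type*) [NormedAddCommGroup X] [NormedSpace ℝ X] : Prop :=
  ∀ E : Submodule ℝ X, FiniteDimensional ℝ E → ∀ ε : ℝ, 0 < ε →
    ∃ y : X, ‖y‖ = 1 ∧ ∀ x ∈ E, ∀ c : ℝ, (1 - ε) * (‖x‖ + |c|) ≤ ‖x + c • y‖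

/-- The real sequence space `ℓ_p`, with its usual norm. -/
abbrev EllP (p : ℝ≥0∞) : Type := lp (fun _ : ℕ => ℝ) p

/-- The real space `L₁[0,1]` with respect to Lebesgue measure. -/
abbrev LOne : Type :=
  MeasureTheory.Lp ℝ 1 (MeasureTheory.volume.restrict (Set.Icc (0 : ℝ) 1))

section

variable (p q : ℝ≥0∞) [Fact (1 ≤ p)] [Fact (1 ≤ q)] [p.HolderConjugate q]

/-- The canonical pairing of `ℓ_p` with `ℓ_q` for conjugate exponents, `(a, x) ↦ ∑ n, a n * x n`,
as a map of `ℓ_p` into the dual of `ℓ_q`. -/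
noncomputable def ellPairing : EllP p →L[ℝ] EllP q →L[ℝ] ℝ :=
  lp.dualPairing p q (fun _ : ℕ => ContinuousLinearMap.mul ℝ ℝ) (K := 1)
    (fun _ => by simp)

theorem ellPairing_apply (a : EllP p) (x : EllP q) :
    ellPairing p q a x = ∑' n, a n * x n := rfl

/-- The algebraic tensor product `ℓ_p ⊗ Y`, viewed inside `L(ℓ_q, Y)`: the linear span of the
operators `a ⊗ y : x ↦ (∑ n, a n * x n) • y` with `a ∈ ℓ_p` and `y ∈ Y`. -/
noncomputable def ellTensor (Y : Type*) [NormedAddCommGroup Y] [NormedSpace ℝ Y] :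
    Submodule ℝ (EllP q →L[ℝ] Y) :=
  Submodule.span ℝ {T | ∃ (a : EllP p) (y : Y), T = (ellPairing p q a).smulRight y}

end

open MeasureTheory Set Filter Topology

/-! Let `q` be the conjugate exponent. Since `p ≥ 2` is finite, `1 < q ≤ 2`, and for such `q` every
finite-dimensional `ℓ_q^N` embeds almost isometrically into some `ℓ_1^M`
(`exists_near_isometry_ellOne`). The targets `ℓ₁` and `L₁` contain isometric copies of `ℓ_1^M` that
are almost `ℓ₁`-orthogonal to any prescribed finite set (`AbsorbsEllOne`).

Given `E`, take a finite net `G` of its unit sphere and, for each `T ∈ G`, a finitely supported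
`x_T` in the unit ball with `‖T x_T‖` close to `1`. Let `S` truncate to the first `N` coordinates,
embed `ℓ_q^N` into `ℓ_1^M`, and then map into `Y` almost orthogonally to all the `T x_T`. This `S`
has finite rank, so it lies in `H`, and `‖T x_T + c • S x_T‖` is nearly `‖T x_T‖ + |c| * ‖S x_T‖`,
hence nearly `1 + |c|`.

The embedding comes from the `q`-stable law, reached as a limit. For `q < 2`, normalized sums `W_k`
of independent symmetric Pareto variables satisfy `E|∑ x_k W_k| → A * ‖x‖_q`. An expectation of
absolute values of linear functionals is a limit of `ℓ₁` seminorms, by convexity; a finite net makes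
the approximation uniform; `q = 2` follows by letting the exponent tend to `2` from below. -/

/-! ### Integrals of `1 - cos` against power weights -/

theorem integrableOn_Ioi_mul_rpow {f : ℝ → ℝ} {a D s r : ℝ} (hs : 0 < s) (hr : s < r)
    (hf : Measurable f) (ha : ∀ t, 0 < t → |f t| ≤ a) (hD : ∀ t, 0 < t → |f t| ≤ D * t ^ r) :
    IntegrableOn (fun t => f t * t ^ (-1 - s)) (Ioi 0) := by
  have hm : Measurable fun t : ℝ => f t * t ^ (-1 - s) := hf.mul (measurable_id.pow_const _)
  rw [← Ioc_union_Ioi_eq_Ioi zero_le_one]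
  refine IntegrableOn.union ?_ ?_
  · have h : IntegrableOn (fun t : ℝ => D * t ^ (r - 1 - s)) (Ioc 0 1) := by
      refine Integrable.const_mul ?_ D
      have := (intervalIntegral.integrableOn_Ioo_rpow_iff (s := r - 1 - s) zero_lt_one).2
        (by linarith)
      exact (integrableOn_Ioc_iff_integrableOn_Ioo).2 this
    refine Integrable.mono' h hm.aestronglyMeasurable ?_
    filter_upwards [ae_restrict_mem measurableSet_Ioc] with t ht
    have h0 : 0 < t := ht.1
    rw [norm_mul, Real.norm_eq_abs, Real.norm_of_nonneg (Real.rpow_nonneg h0.le _)]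
    calc |f t| * t ^ (-1 - s) ≤ D * t ^ r * t ^ (-1 - s) := by gcongr; exact hD t h0
      _ = D * t ^ (r - 1 - s) := by
        rw [mul_assoc, ← Real.rpow_add h0]; ring_nf
  · have h : IntegrableOn (fun t : ℝ => a * t ^ (-1 - s)) (Ioi 1) :=
      (integrableOn_Ioi_rpow_of_lt (by linarith) zero_lt_one).const_mul a
    refine Integrable.mono' h hm.aestronglyMeasurable ?_
    filter_upwards [ae_restrict_mem measurableSet_Ioi] with t ht
    have h0 : 0 < t := lt_trans zero_lt_one ht
    rw [norm_mul, Real.norm_eq_abs, Real.norm_of_nonneg (Real.rpow_nonneg h0.le _)]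
    gcongr; exact ha t h0

theorem setIntegral_Ioi_comp_mul_mul_rpow (f : ℝ → ℝ) (s b : ℝ) {c : ℝ} (hc : 0 < c)
    (hb : 0 ≤ b) :
    ∫ t in Ioi b, f (c * t) * t ^ (-1 - s) = c ^ s * ∫ t in Ioi (c * b), f t * t ^ (-1 - s) := by
  have h := integral_comp_mul_left_Ioi (fun t => f t * t ^ (-1 - s)) b hc
  have h2 : ∫ t in Ioi b, f (c * t) * (c * t) ^ (-1 - s)
      = c ^ (-1 - s) * ∫ t in Ioi b, f (c * t) * t ^ (-1 - s) := by
    rw [← integral_const_mul]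
    refine setIntegral_congr_fun measurableSet_Ioi fun t ht => ?_
    rw [Real.mul_rpow hc.le (hb.trans (le_of_lt ht))]; ring
  rw [h2, smul_eq_mul] at h
  have h3 : c ^ s * c ^ (-1 - s) * c = 1 := by
    rw [← Real.rpow_add hc, ← Real.rpow_add_one hc.ne']; ring_nf; simp
  have h4 : c * c⁻¹ = 1 := mul_inv_cancel₀ hc.ne'
  calc ∫ t in Ioi b, f (c * t) * t ^ (-1 - s)
      = (c ^ s * c ^ (-1 - s) * c) * ∫ t in Ioi b, f (c * t) * t ^ (-1 - s) := by rw [h3, one_mul]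
    _ = c ^ s * c * (c ^ (-1 - s) * ∫ t in Ioi b, f (c * t) * t ^ (-1 - s)) := by ring
    _ = c ^ s * (c * c⁻¹) * ∫ t in Ioi (c * b), f t * t ^ (-1 - s) := by rw [h]; ring
    _ = _ := by rw [h4, mul_one]

theorem abs_one_sub_cos_le_two (t : ℝ) : |1 - Real.cos t| ≤ 2 := by
  rw [abs_le]; constructor <;> linarith [Real.cos_le_one t, Real.neg_one_le_cos t]

theorem abs_one_sub_cos_le_sq (t : ℝ) : |1 - Real.cos t| ≤ 1 / 2 * t ^ (2 : ℝ) := by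
  rw [abs_of_nonneg (by linarith [Real.cos_le_one t]), Real.rpow_two]
  linarith [Real.one_sub_sq_div_two_le_cos (x := t)]

/-- The integral of `(1 - cos t) * t ^ (-1 - s)` over the positive half line. -/
noncomputable def cosConst (s : ℝ) : ℝ := ∫ t in Ioi 0, (1 - Real.cos t) * t ^ (-1 - s)

theorem integrableOn_one_sub_cos_mul_rpow {s : ℝ} (hs : 0 < s) (hs2 : s < 2) :
    IntegrableOn (fun t => (1 - Real.cos t) * t ^ (-1 - s)) (Ioi 0) :=
  integrableOn_Ioi_mul_rpow hs hs2 (by fun_prop) (fun t _ => abs_one_sub_cos_le_two t)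
    (fun t _ => abs_one_sub_cos_le_sq t)

theorem setIntegral_Ioi_zero_pos {f : ℝ → ℝ} (hf : IntegrableOn f (Ioi 0))
    (h0 : ∀ t, 0 < t → 0 ≤ f t) (h1 : ∀ t ∈ Ioo (0 : ℝ) 1, 0 < f t) :
    0 < ∫ t in Ioi 0, f t := by
  rw [setIntegral_pos_iff_support_of_nonneg_ae _ hf]
  · have : Ioo (0 : ℝ) 1 ⊆ Function.support f ∩ Ioi 0 := fun t ht =>
      ⟨(h1 t ht).ne', ht.1⟩
    refine lt_of_lt_of_le ?_ (measure_mono this)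
    simp
  · filter_upwards [ae_restrict_mem measurableSet_Ioi] with t ht using h0 t ht

theorem cosConst_pos {s : ℝ} (hs : 0 < s) (hs2 : s < 2) : 0 < cosConst s := by
  refine setIntegral_Ioi_zero_pos (integrableOn_one_sub_cos_mul_rpow hs hs2) ?_ ?_
  · intro t ht
    exact mul_nonneg (by linarith [Real.cos_le_one t]) (Real.rpow_nonneg ht.le _)
  · intro t ht
    refine mul_pos ?_ (Real.rpow_pos_of_pos ht.1 _)
    have := Real.cos_lt_cos_of_nonneg_of_le_pi_div_two le_rfl
      (by linarith [Real.pi_gt_three, ht.2] : t ≤ Real.pi / 2) ht.1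
    rw [Real.cos_zero] at this
    linarith

/-- Substitute `t ↦ |y| * t`. At `s = 1` this writes `|y|` as an integral of cosines, which ties
first absolute moments to characteristic functions. -/
theorem integral_one_sub_cos_mul {s : ℝ} (hs : 0 < s) (y : ℝ) :
    ∫ t in Ioi 0, (1 - Real.cos (t * y)) * t ^ (-1 - s) = |y| ^ s * cosConst s := by
  rcases eq_or_ne y 0 with rfl | hy
  · simp [Real.zero_rpow hs.ne']
  · have h := setIntegral_Ioi_comp_mul_mul_rpow (fun t => 1 - Real.cos t) s 0 (abs_pos.2 hy) le_rfl
    rw [mul_zero] at h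
    rw [cosConst, ← h]
    congr 1; ext t
    rw [← Real.cos_abs (t * y), ← Real.cos_abs (|y| * t), abs_mul, abs_mul, abs_abs, mul_comm |t|]

theorem integrableOn_one_sub_cos_mul {s : ℝ} (hs : 0 < s) (hs2 : s < 2) (y : ℝ) :
    IntegrableOn (fun t => (1 - Real.cos (t * y)) * t ^ (-1 - s)) (Ioi 0) := by
  refine integrableOn_Ioi_mul_rpow (D := 1 / 2 * |y| ^ (2 : ℝ)) hs hs2 (by fun_prop)
    (fun t _ => abs_one_sub_cos_le_two _) (fun t ht => ?_)
  refine (abs_one_sub_cos_le_sq _).trans_eq ?_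
  simp only [Real.rpow_two, sq_abs]; ring

theorem tendsto_setIntegral_Ioi_of_tendsto_zero {f : ℝ → ℝ} (hf : IntegrableOn f (Ioi 0))
    {s : ℕ → ℝ} (h0 : ∀ n, 0 ≤ s n) (hs : Tendsto s atTop (𝓝 0)) :
    Tendsto (fun n => ∫ t in Ioi (s n), f t) atTop (𝓝 (∫ t in Ioi 0, f t)) := by
  have h : ∀ n, ∫ t in Ioi (s n), f t = ∫ t in Ioi 0, (Ioi (s n)).indicator f t := fun n => by
    rw [setIntegral_indicator measurableSet_Ioi, inter_eq_right.2 (Ioi_subset_Ioi (h0 n))]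
  simp_rw [h]
  refine tendsto_integral_of_dominated_convergence (fun t => ‖f t‖)
    (fun n => (hf.indicator measurableSet_Ioi).aestronglyMeasurable) hf.norm
    (fun n => ae_of_all _ fun t => norm_indicator_le_norm_self _ _) ?_
  filter_upwards [ae_restrict_mem measurableSet_Ioi] with t ht
  refine tendsto_const_nhds.congr' ?_
  filter_upwards [hs.eventually_lt_const ht] with n hn
  rw [indicator_of_mem (mem_Ioi.2 hn)]

/-! ### The symmetric Pareto law and its characteristic function -/

/-- The Pareto distribution with scale `1` and shape `q`. -/
noncomputable def paretoLaw (q : ℝ) : Measure ℝ :=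
  (volume.restrict (Ioi 1)).withDensity fun u => ENNReal.ofReal (q * u ^ (-1 - q))

theorem integral_paretoLaw {q : ℝ} (hq : 0 < q) {E : Type*} [NormedAddCommGroup E]
    [NormedSpace ℝ E] (f : ℝ → E) :
    ∫ u, f u ∂paretoLaw q = ∫ u in Ioi 1, (q * u ^ (-1 - q)) • f u := by
  rw [paretoLaw, integral_withDensity_eq_integral_toReal_smul (by fun_prop) (by simp)]
  refine setIntegral_congr_fun measurableSet_Ioi fun u hu => ?_
  have : 0 < u := lt_trans zero_lt_one hu
  rw [ENNReal.toReal_ofReal (by positivity)]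

theorem integrable_paretoLaw_iff {q : ℝ} (hq : 0 < q) (f : ℝ → ℝ) :
    Integrable f (paretoLaw q) ↔ IntegrableOn (fun u => f u * (q * u ^ (-1 - q))) (Ioi 1) := by
  rw [paretoLaw, integrable_withDensity_iff (by fun_prop) (by simp)]
  refine integrableOn_congr_fun (fun u hu => ?_) measurableSet_Ioi
  have : 0 < u := lt_trans zero_lt_one hu
  rw [ENNReal.toReal_ofReal (by positivity)]

theorem integral_Ioi_one_rpow {q : ℝ} (hq : 0 < q) : ∫ u in Ioi (1 : ℝ), q * u ^ (-1 - q) = 1 := by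
  rw [integral_const_mul, integral_Ioi_rpow_of_lt (by linarith) zero_lt_one, Real.one_rpow,
    show -1 - q + 1 = -q by ring, neg_div_neg_eq, mul_one_div_cancel hq.ne']

theorem integrableOn_Ioi_one_rpow {q : ℝ} (hq : 0 < q) :
    IntegrableOn (fun u => q * u ^ (-1 - q)) (Ioi (1 : ℝ)) :=
  (integrableOn_Ioi_rpow_of_lt (by linarith) zero_lt_one).const_mul q

theorem isProbabilityMeasure_paretoLaw {q : ℝ} (hq : 0 < q) :
    IsProbabilityMeasure (paretoLaw q) := by
  constructor
  rw [paretoLaw, withDensity_apply _ MeasurableSet.univ, Measure.restrict_univ,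
    ← ofReal_integral_eq_lintegral_ofReal (integrableOn_Ioi_one_rpow hq), integral_Ioi_one_rpow hq,
    ENNReal.ofReal_one]
  filter_upwards [ae_restrict_mem measurableSet_Ioi] with u hu
  have : 0 < u := lt_trans zero_lt_one hu
  simp only [Pi.zero_apply]
  positivity

theorem integrable_id_paretoLaw {q : ℝ} (hq : 1 < q) :
    Integrable (fun u => u) (paretoLaw q) := by
  rw [integrable_paretoLaw_iff (by linarith)]
  have h : IntegrableOn (fun u : ℝ => q * u ^ (-q)) (Ioi 1) :=
    (integrableOn_Ioi_rpow_of_lt (by linarith) zero_lt_one).const_mul q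
  refine h.congr_fun (fun u hu => ?_) measurableSet_Ioi
  have h0 : 0 < u := lt_trans zero_lt_one hu
  have : u ^ (-q) = u * u ^ (-1 - q) := by
    rw [mul_comm, ← Real.rpow_add_one h0.ne']; ring_nf
  simp only
  rw [this]; ring

/-- The substitution `v = |t| * u` moves the lower limit from `1` to `|t|`. The remaining integral
is at most `cosConst q` and tends to it as `t → 0` (for `q < 2`), which gives both the global bound
and the asymptotics at `0`. -/
theorem one_sub_integral_cos_paretoLaw {q : ℝ} (hq : 0 < q) (t : ℝ) :
    1 - ∫ u, Real.cos (t * u) ∂paretoLaw q =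
      q * |t| ^ q * ∫ v in Ioi |t|, (1 - Real.cos v) * v ^ (-1 - q) := by
  have := isProbabilityMeasure_paretoLaw hq
  have hint : Integrable (fun u => Real.cos (t * u)) (paretoLaw q) :=
    Integrable.of_bound (C := 1) (by fun_prop) (ae_of_all _ fun u => Real.abs_cos_le_one _)
  have h1 : 1 - ∫ u, Real.cos (t * u) ∂paretoLaw q = ∫ u, (1 - Real.cos (t * u)) ∂paretoLaw q := by
    rw [integral_sub (integrable_const _) hint]; simp
  rw [h1, integral_paretoLaw hq]
  have h2 : ∫ u in Ioi (1 : ℝ), (q * u ^ (-1 - q)) • (1 - Real.cos (t * u)) =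
      q * ∫ u in Ioi (1 : ℝ), (1 - Real.cos (|t| * u)) * u ^ (-1 - q) := by
    rw [← integral_const_mul]
    refine setIntegral_congr_fun measurableSet_Ioi fun u hu => ?_
    have h0 : 0 < u := lt_trans zero_lt_one hu
    simp only [smul_eq_mul]
    rw [← Real.cos_abs (t * u), abs_mul, abs_of_pos h0]; ring
  rw [h2]
  rcases eq_or_ne t 0 with rfl | ht
  · simp [Real.zero_rpow hq.ne']
  · rw [setIntegral_Ioi_comp_mul_mul_rpow (fun t => 1 - Real.cos t) q 1 (abs_pos.2 ht) zero_le_one,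
      mul_one, mul_assoc]

/-- The symmetrization of the Pareto distribution. -/
noncomputable def symParetoLaw (q : ℝ) : Measure ℝ :=
  (2⁻¹ : ℝ≥0∞) • (paretoLaw q + (paretoLaw q).map Neg.neg)

theorem isProbabilityMeasure_symParetoLaw {q : ℝ} (hq : 0 < q) :
    IsProbabilityMeasure (symParetoLaw q) := by
  have := isProbabilityMeasure_paretoLaw hq
  constructor
  rw [symParetoLaw, Measure.smul_apply, Measure.add_apply,
    Measure.map_apply measurable_neg MeasurableSet.univ, preimage_univ, measure_univ, smul_eq_mul,
    one_add_one_eq_two]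
  exact ENNReal.inv_mul_cancel (by simp) (by simp)

theorem integrable_id_symParetoLaw {q : ℝ} (hq : 1 < q) :
    Integrable (fun u => u) (symParetoLaw q) := by
  refine Integrable.smul_measure (Integrable.add_measure (integrable_id_paretoLaw hq) ?_) (by simp)
  rw [integrable_map_measure (by fun_prop) (by fun_prop)]
  exact (integrable_id_paretoLaw hq).neg

/-- Averaging over `u` and `-u` cancels the sine part. -/
theorem integral_cexp_symParetoLaw {q : ℝ} (hq : 0 < q) (t : ℝ) :
    ∫ u, Complex.exp ((t * u : ℝ) * Complex.I) ∂symParetoLaw q =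
      ((∫ u, Real.cos (t * u) ∂paretoLaw q : ℝ) : ℂ) := by
  have := isProbabilityMeasure_paretoLaw hq
  have hb : ∀ (μ : Measure ℝ) [IsFiniteMeasure μ],
      Integrable (fun u : ℝ => Complex.exp ((t * u : ℝ) * Complex.I)) μ := fun μ _ =>
    Integrable.of_bound (C := 1) (by fun_prop)
      (ae_of_all _ fun u => (Complex.norm_exp_ofReal_mul_I _).le)
  rw [symParetoLaw, integral_smul_measure, integral_add_measure (hb _)
    (by have := Measure.isFiniteMeasure_map (paretoLaw q) Neg.neg; exact hb _),
    integral_map (by fun_prop) (by fun_prop), ← integral_add (hb _)]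
  · rw [← integral_smul, ← integral_complex_ofReal]
    congr 1; ext u
    rw [Complex.ofReal_cos, Complex.cos]
    simp only [ENNReal.toReal_inv, ENNReal.toReal_ofNat, mul_neg, Complex.ofReal_neg,
      Complex.real_smul, Complex.ofReal_inv, Complex.ofReal_ofNat]
    ring
  · refine Integrable.of_bound (C := 1) (by fun_prop)
      (ae_of_all _ fun u => (Complex.norm_exp_ofReal_mul_I _).le)

/-- For `1 < q < 2` there is a symmetric integrable law in the domain of normal attraction of the
symmetric `q`-stable law. -/
theorem exists_law_attracted_to_stable {q : ℝ} (hq1 : 1 < q) (hq2 : q < 2) :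
    ∃ (μ : Measure ℝ) (φ : ℝ → ℝ) (C : ℝ), IsProbabilityMeasure μ ∧ Integrable (fun u => u) μ ∧
      Measurable φ ∧ 0 < C ∧ (∀ t : ℝ, ∫ u, Complex.exp ((t * u : ℝ) * Complex.I) ∂μ = φ t) ∧
      (∀ t, |φ t| ≤ 1) ∧ (∀ t, 1 - φ t ≤ C * |t| ^ q) ∧
      ∀ t, Tendsto (fun n : ℕ => n * (1 - φ (t * (n : ℝ) ^ (-1 / q)))) atTop (𝓝 (C * |t| ^ q)) := by
  have hq : 0 < q := by linarith
  have hP := isProbabilityMeasure_paretoLaw hq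
  have hint := integrableOn_one_sub_cos_mul_rpow hq hq2
  refine ⟨symParetoLaw q, fun t => ∫ u, Real.cos (t * u) ∂paretoLaw q, q * cosConst q,
    isProbabilityMeasure_symParetoLaw hq, integrable_id_symParetoLaw hq1, ?_,
    mul_pos hq (cosConst_pos hq hq2), integral_cexp_symParetoLaw hq, ?_, ?_, ?_⟩
  · exact (StronglyMeasurable.integral_prod_right (f := fun t u : ℝ => Real.cos (t * u))
      (by fun_prop : Continuous _).stronglyMeasurable).measurable
  · intro t
    have := norm_integral_le_of_norm_le_const (μ := paretoLaw q)
      (f := fun u => Real.cos (t * u)) (C := 1) (ae_of_all _ fun u => Real.abs_cos_le_one _)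
    simpa using this
  · intro t
    rw [one_sub_integral_cos_paretoLaw hq, mul_assoc, mul_assoc, mul_comm (cosConst q)]
    gcongr
    refine setIntegral_mono_set hint ?_ (Ioi_subset_Ioi (abs_nonneg t)).eventuallyLE
    filter_upwards [ae_restrict_mem measurableSet_Ioi] with u hu
    exact mul_nonneg (by linarith [Real.cos_le_one u]) (Real.rpow_nonneg (le_of_lt hu) _)
  · intro t
    have h1 : Tendsto (fun n : ℕ => |t * (n : ℝ) ^ (-1 / q)|) atTop (𝓝 0) := by
      have : Tendsto (fun n : ℕ => (n : ℝ) ^ (-(1 / q))) atTop (𝓝 0) :=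
        (tendsto_rpow_neg_atTop (by positivity)).comp tendsto_natCast_atTop_atTop
      have := (this.const_mul t).abs
      simpa [neg_div] using this
    have h2 := (tendsto_setIntegral_Ioi_of_tendsto_zero hint (fun n => abs_nonneg _) h1).const_mul
      (q * |t| ^ q)
    rw [show q * cosConst q * |t| ^ q = q * |t| ^ q * cosConst q by ring]
    refine h2.congr' ?_
    filter_upwards [eventually_gt_atTop 0] with n hn
    have hn' : (0 : ℝ) < n := by exact_mod_cast hn
    rw [one_sub_integral_cos_paretoLaw hq]
    have : |t * (n : ℝ) ^ (-1 / q)| ^ q = |t| ^ q * (n : ℝ)⁻¹ := by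
      rw [abs_mul, abs_of_pos (Real.rpow_pos_of_pos hn' _), Real.mul_rpow (abs_nonneg _)
        (Real.rpow_nonneg hn'.le _), ← Real.rpow_mul hn'.le, div_mul_cancel₀ _ hq.ne',
        Real.rpow_neg_one]
    rw [this]
    field_simp

/-! ### Absolute moments of sums of independent variables -/

theorem integral_cos_pi {ι : Type*} [Fintype ι] (μ : Measure ℝ) [IsProbabilityMeasure μ]
    {φ : ℝ → ℝ} (hφ : ∀ t : ℝ, ∫ u, Complex.exp ((t * u : ℝ) * Complex.I) ∂μ = φ t)
    (b : ι → ℝ) (t : ℝ) :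
    ∫ ω, Real.cos (t * ∑ i, b i * ω i) ∂Measure.pi (fun _ : ι => μ) = ∏ i, φ (t * b i) := by
  have h := integral_fintype_prod_eq_prod (μ := fun _ : ι => μ)
    (fun (i : ι) (u : ℝ) => Complex.exp ((t * b i * u : ℝ) * Complex.I))
  simp_rw [hφ, ← Complex.exp_sum, ← Finset.sum_mul, ← Complex.ofReal_sum] at h
  have h3 : Integrable (fun ω : ι → ℝ => Complex.exp ((∑ i, t * b i * ω i : ℝ) * Complex.I))
      (Measure.pi fun _ : ι => μ) :=
    Integrable.of_bound (C := 1) (Continuous.aestronglyMeasurable (by fun_prop))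
      (ae_of_all _ fun u => (Complex.norm_exp_ofReal_mul_I _).le)
  have h2 := congrArg Complex.re h
  rw [← Complex.ofReal_prod, Complex.ofReal_re] at h2
  rw [← h2, ← RCLike.re_eq_complex_re, ← integral_re h3]
  congr 1; ext ω
  rw [RCLike.re_eq_complex_re, Complex.exp_ofReal_mul_I_re, Finset.mul_sum]
  simp_rw [mul_assoc]

theorem abs_prod_le_one {ι : Type*} (s : Finset ι) {z : ι → ℝ} (hz : ∀ i ∈ s, |z i| ≤ 1) :
    |∏ i ∈ s, z i| ≤ 1 := by
  rw [Finset.abs_prod]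
  exact Finset.prod_le_one (fun _ _ => abs_nonneg _) hz

/-- Induction on `(1 - a) + (1 - b) - (1 - a * b) = (1 - a) * (1 - b) ≥ 0`. -/
theorem one_sub_prod_le_sum {ι : Type*} (s : Finset ι) {z : ι → ℝ} (hz : ∀ i, |z i| ≤ 1) :
    1 - ∏ i ∈ s, z i ≤ ∑ i ∈ s, (1 - z i) := by
  classical
  induction s using Finset.induction_on with
  | empty => simp
  | insert i s hi ih =>
    rw [Finset.prod_insert hi, Finset.sum_insert hi]
    have h1 := abs_le.1 (hz i)
    have h2 := abs_le.1 (abs_prod_le_one s fun i _ => hz i)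
    nlinarith

/-- Apply the cosine formula for `|y|` to `y = ∑ b i * ω i` and exchange integrals; the integrand is
nonnegative for `t > 0`, so the finite first moment justifies Fubini. -/
theorem integral_abs_pi {ι : Type*} [Fintype ι] (μ : Measure ℝ) [IsProbabilityMeasure μ]
    {φ : ℝ → ℝ} (hφ : ∀ t : ℝ, ∫ u, Complex.exp ((t * u : ℝ) * Complex.I) ∂μ = φ t)
    (hμ : Integrable (fun u => u) μ) (b : ι → ℝ) :
    (∫ ω, |∑ i, b i * ω i| ∂Measure.pi (fun _ : ι => μ)) * cosConst 1 =
      ∫ t in Ioi 0, (1 - ∏ i, φ (t * b i)) * t ^ (-1 - 1 : ℝ) := by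
  set P := Measure.pi (fun _ : ι => μ)
  have hP : Integrable (fun ω : ι → ℝ => |∑ i, b i * ω i|) P := by
    refine (integrable_finsetSum _ fun i _ => Integrable.const_mul ?_ _).abs
    exact integrable_comp_eval (μ := fun _ : ι => μ) hμ
  have hc : ∀ t : ℝ, Integrable (fun ω : ι → ℝ => Real.cos (t * ∑ i, b i * ω i)) P := fun t =>
    Integrable.of_bound (C := 1) (Continuous.aestronglyMeasurable (by fun_prop))
      (ae_of_all _ fun u => Real.abs_cos_le_one _)
  have h1 : ∀ t : ℝ, (1 - ∏ i, φ (t * b i)) * t ^ (-1 - 1 : ℝ) =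
      ∫ ω, (1 - Real.cos (t * ∑ i, b i * ω i)) * t ^ (-1 - 1 : ℝ) ∂P := fun t => by
    rw [integral_mul_const, integral_sub (integrable_const _) (hc t), integral_cos_pi μ hφ]
    simp
  simp_rw [h1]
  rw [← integral_mul_const, integral_integral_swap]
  · refine integral_congr_ae (ae_of_all _ fun ω => ?_)
    have := integral_one_sub_cos_mul one_pos (∑ i, b i * ω i)
    simp only
    rw [this, Real.rpow_one]
  · have hm : AEStronglyMeasurable (fun z : ℝ × (ι → ℝ) =>
        (1 - Real.cos (z.1 * ∑ i, b i * z.2 i)) * z.1 ^ (-1 - 1 : ℝ))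
        ((volume.restrict (Ioi 0)).prod P) := by
      refine Measurable.aestronglyMeasurable (Measurable.mul ?_ (measurable_fst.pow_const _))
      exact Continuous.measurable (by fun_prop)
    refine (integrable_prod_iff' hm).2 ⟨ae_of_all _ fun ω => ?_, ?_⟩
    · exact integrableOn_one_sub_cos_mul one_pos one_lt_two (∑ i, b i * ω i)
    · refine (hP.mul_const (cosConst 1)).congr (ae_of_all _ fun ω => ?_)
      have := integral_one_sub_cos_mul one_pos (∑ i, b i * ω i)
      rw [Real.rpow_one] at this
      simp only
      rw [← this]
      refine setIntegral_congr_fun measurableSet_Ioi fun t ht => ?_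
      rw [Real.norm_of_nonneg]
      exact mul_nonneg (by linarith [Real.cos_le_one (t * ∑ i, b i * ω i)])
        (Real.rpow_nonneg (le_of_lt ht) _)

/-- For `1 < q < 2` the `ℓ_q` norm on `ℝ^N` is, up to a constant, a pointwise limit of first absolute
moments of linear functionals of random vectors. -/
theorem exists_integral_abs_tendsto {q : ℝ} (hq1 : 1 < q) (hq2 : q < 2) (N : ℕ) :
    ∃ (P : ∀ n : ℕ, Measure (Fin N × Fin n → ℝ)) (W : ∀ n : ℕ, (Fin N × Fin n → ℝ) → Fin N → ℝ)
      (A : ℝ), 0 < A ∧ (∀ n, IsProbabilityMeasure (P n)) ∧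
      (∀ n k, Integrable (fun ω => W n ω k) (P n)) ∧
      ∀ x : Fin N → ℝ, Tendsto (fun n => ∫ ω, |∑ k, x k * W n ω k| ∂P n) atTop
        (𝓝 (A * (∑ k, |x k| ^ q) ^ (1 / q))) := by
  have hq : 0 < q := by linarith
  obtain ⟨μ, φ, C, hμ, hint, hφm, hC, hφ, hφ1, hφC, hlim⟩ :=
    exists_law_attracted_to_stable hq1 hq2
  set f : ℝ → ℝ := fun t => 1 - Real.exp (-(C * |t| ^ q)) with hf
  have hf0 : ∀ t, 0 ≤ f t := fun t => by
    have : Real.exp (-(C * |t| ^ q)) ≤ 1 := Real.exp_le_one_iff.2 (by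
      have := Real.rpow_nonneg (abs_nonneg t) q
      nlinarith)
    simp only [hf]; linarith
  have hfint : IntegrableOn (fun t => f t * t ^ (-1 - 1 : ℝ)) (Ioi 0) := by
    refine integrableOn_Ioi_mul_rpow (a := 1) (D := C) one_pos hq1 (by fun_prop) ?_ ?_
    · intro t _
      rw [abs_of_nonneg (hf0 t)]
      simp only [hf]; linarith [Real.exp_pos (-(C * |t| ^ q))]
    · intro t ht
      rw [abs_of_nonneg (hf0 t)]
      simp only [hf, abs_of_pos ht]; linarith [Real.add_one_le_exp (-(C * t ^ q))]
  set A := ∫ t in Ioi 0, f t * t ^ (-1 - 1 : ℝ) with hA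
  have hA0 : 0 < A := by
    refine setIntegral_Ioi_zero_pos hfint
      (fun t ht => mul_nonneg (hf0 t) (Real.rpow_nonneg ht.le _)) fun t ht => ?_
    refine mul_pos ?_ (Real.rpow_pos_of_pos ht.1 _)
    have := Real.rpow_pos_of_pos (abs_pos.2 ht.1.ne') q
    have : Real.exp (-(C * |t| ^ q)) < 1 := Real.exp_lt_one_iff.2 (by nlinarith)
    simp only [hf]; linarith
  have hK := cosConst_pos one_pos one_lt_two
  have hcoord : ∀ n (i : Fin N × Fin n),
      Integrable (fun ω : Fin N × Fin n → ℝ => ω i) (Measure.pi fun _ => μ) := fun n i =>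
    integrable_comp_eval (μ := fun _ : Fin N × Fin n => μ) hint
  -- Each coordinate of `W n` is a sum of `n` independent copies scaled by `n ^ (-1 / q)`, the
  -- normalization under which the law converges to a stable one.
  refine ⟨fun n => Measure.pi fun _ => μ, fun n ω k => ∑ j, (n : ℝ) ^ (-1 / q) * ω (k, j),
    A / cosConst 1, by positivity, fun n => inferInstance, fun n k =>
      integrable_finsetSum _ fun j _ => (hcoord n _).const_mul _, fun x => ?_⟩
  set D := ∑ k, |x k| ^ q with hD
  have hD0 : 0 ≤ D := Finset.sum_nonneg fun k _ => Real.rpow_nonneg (abs_nonneg _) _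
  have hkey : ∀ n : ℕ, ∫ ω, |∑ k, x k * ∑ j, (n : ℝ) ^ (-1 / q) * ω (k, j)|
      ∂(Measure.pi fun _ : Fin N × Fin n => μ) =
      (∫ t in Ioi 0, (1 - ∏ k, φ (t * x k * (n : ℝ) ^ (-1 / q)) ^ n) * t ^ (-1 - 1 : ℝ))
        / cosConst 1 := fun n => by
    rw [eq_div_iff hK.ne']
    have := integral_abs_pi μ hφ hint (fun i : Fin N × Fin n => x i.1 * (n : ℝ) ^ (-1 / q))
    simp_rw [Fintype.sum_prod_type, Fintype.prod_prod_type, Finset.prod_const, Finset.card_univ,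
      Fintype.card_fin, ← mul_assoc] at this
    simp_rw [Finset.mul_sum, ← mul_assoc]
    exact this
  simp_rw [hkey]
  rw [div_mul_eq_mul_div]
  refine Tendsto.div_const ?_ _
  -- The limiting integrand is `f (D ^ (1 / q) * t)`, and scaling with weight `t ^ (-2)` pulls out
  -- exactly `D ^ (1 / q)`.
  have hlimval : A * D ^ (1 / q) = ∫ t in Ioi 0, (1 - ∏ k, Real.exp (-(C * |t * x k| ^ q))) *
      t ^ (-1 - 1 : ℝ) := by
    have hexp : ∀ t, 0 < t → 1 - ∏ k, Real.exp (-(C * |t * x k| ^ q)) = f (D ^ (1 / q) * t) := by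
      intro t ht
      rw [← Real.exp_sum]
      simp only [hf]
      congr 2
      rw [abs_of_nonneg (by positivity), Real.mul_rpow (by positivity) ht.le, ← Real.rpow_mul hD0,
        one_div_mul_cancel hq.ne', Real.rpow_one, Finset.sum_neg_distrib, hD, Finset.sum_mul,
        Finset.mul_sum]
      congr 1
      refine Finset.sum_congr rfl fun k _ => ?_
      rw [abs_mul, Real.mul_rpow (abs_nonneg _) (abs_nonneg _), abs_of_pos ht]; ring
    rw [setIntegral_congr_fun measurableSet_Ioi (g := fun t => f (D ^ (1 / q) * t) *
      t ^ (-1 - 1 : ℝ)) fun t ht => by simp only; rw [hexp t ht]]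
    rcases hD0.eq_or_lt with h0 | h0
    · simp [← h0, hf, Real.zero_rpow hq.ne', Real.zero_rpow (inv_ne_zero hq.ne')]
    · rw [setIntegral_Ioi_comp_mul_mul_rpow f 1 0 (Real.rpow_pos_of_pos h0 _) le_rfl, mul_zero,
        Real.rpow_one, mul_comm]
  rw [hlimval]
  -- A majorant independent of `n`; it is integrable against `t ^ (-2)` because `q > 1`.
  have hbd : ∀ n : ℕ, ∀ t, 0 < t → |1 - ∏ k, φ (t * x k * (n : ℝ) ^ (-1 / q)) ^ n| ≤
      min 2 (C * D * t ^ q) := by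
    intro n t ht
    have hpow : ∀ k, |φ (t * x k * (n : ℝ) ^ (-1 / q)) ^ n| ≤ 1 := fun k => by
      rw [abs_pow]; exact pow_le_one₀ (abs_nonneg _) (hφ1 _)
    have h1 := abs_le.1 (abs_prod_le_one Finset.univ fun k _ => hpow k)
    rw [abs_of_nonneg (by linarith)]
    refine le_min (by linarith) ((one_sub_prod_le_sum _ hpow).trans ?_)
    rw [hD, Finset.mul_sum, Finset.sum_mul]
    refine Finset.sum_le_sum fun k _ => ?_
    have h2 := one_sub_prod_le_sum (Finset.univ : Finset (Fin n))
      (z := fun _ => φ (t * x k * (n : ℝ) ^ (-1 / q))) fun _ => hφ1 _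
    simp only [Finset.prod_const, Finset.sum_const, Finset.card_univ, Fintype.card_fin,
      nsmul_eq_mul] at h2
    refine h2.trans ?_
    rcases Nat.eq_zero_or_pos n with rfl | hn
    · have := Real.rpow_nonneg (abs_nonneg (x k)) q
      have := Real.rpow_nonneg ht.le q
      simp only [Nat.cast_zero, zero_mul]; positivity
    have hn' : (0 : ℝ) < n := by exact_mod_cast hn
    calc n * (1 - φ (t * x k * (n : ℝ) ^ (-1 / q)))
        ≤ n * (C * |t * x k * (n : ℝ) ^ (-1 / q)| ^ q) := by gcongr; exact hφC _
      _ = C * |x k| ^ q * t ^ q := by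
        rw [abs_mul, abs_mul, abs_of_pos ht, abs_of_pos (Real.rpow_pos_of_pos hn' _),
          Real.mul_rpow (by positivity) (Real.rpow_nonneg hn'.le _), Real.mul_rpow ht.le
          (abs_nonneg _), ← Real.rpow_mul hn'.le, div_mul_cancel₀ _ hq.ne', Real.rpow_neg_one]
        field_simp
  have hbint : IntegrableOn (fun t => min 2 (C * D * t ^ q) * t ^ (-1 - 1 : ℝ)) (Ioi 0) := by
    refine integrableOn_Ioi_mul_rpow (a := 2) (D := C * D) one_pos hq1 (by fun_prop) ?_ ?_
    all_goals
      intro t ht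
      have := Real.rpow_nonneg ht.le q
      rw [abs_of_nonneg (by positivity)]
    · exact min_le_left _ _
    · exact min_le_right _ _
  refine tendsto_integral_of_dominated_convergence
    (fun t => min 2 (C * D * t ^ q) * t ^ (-1 - 1 : ℝ)) (fun n => ?_) hbint (fun n => ?_) ?_
  · refine Measurable.aestronglyMeasurable (Measurable.mul (by fun_prop) ?_)
    exact measurable_id.pow_const _
  · filter_upwards [ae_restrict_mem measurableSet_Ioi] with t ht
    rw [norm_mul, Real.norm_eq_abs, Real.norm_of_nonneg (Real.rpow_nonneg (le_of_lt ht) _)]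
    gcongr
    · exact Real.rpow_nonneg (le_of_lt ht) _
    · exact hbd n t ht
  · refine ae_of_all _ fun t => ?_
    refine (tendsto_const_nhds.sub (tendsto_finsetProd _ fun k _ => ?_)).mul_const _
    have := (hlim (t * x k)).neg
    have h2 := Real.tendsto_one_add_pow_exp_of_tendsto
      (g := fun n : ℕ => φ (t * x k * (n : ℝ) ^ (-1 / q)) - 1) (t := -(C * |t * x k| ^ q))
      (this.congr fun n => by ring)
    exact h2.congr fun n => by ring

/-! ### Almost isometric embedding of `ℓ_q^N` into `ℓ_1^M` -/

/-- The restrictions to the points `X c` of the norms induced by linear maps into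
finite-dimensional `ℓ₁` spaces. -/
def ellOneSeminorms {κ : Type*} {N : ℕ} (X : κ → Fin N → ℝ) : Set (κ → ℝ) :=
  {z | ∃ (M : ℕ) (a : Fin M → Fin N → ℝ), ∀ c, z c = ∑ i, |∑ k, a i k * X c k|}

theorem convex_ellOneSeminorms {κ : Type*} {N : ℕ} (X : κ → Fin N → ℝ) :
    Convex ℝ (ellOneSeminorms X) := by
  rintro z ⟨M, a, hz⟩ z' ⟨M', a', hz'⟩ s t hs ht -
  refine ⟨M + M', Fin.append (s • a) (t • a'), fun c => ?_⟩
  rw [Fin.sum_univ_add]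
  simp only [Fin.append_left, Fin.append_right, Pi.smul_apply, smul_eq_mul, Pi.add_apply, hz, hz',
    mul_assoc, ← Finset.mul_sum, abs_mul, abs_of_nonneg hs, abs_of_nonneg ht]

/-- For each `ω`, the absolute value of one functional is a one-row `ℓ₁` seminorm. The closure is
closed and convex, so it contains the averages over `ω` and then their limit as `n → ∞`. -/
theorem ellNorm_mem_closure_of_lt_two {κ : Type*} [Fintype κ] {N : ℕ} (X : κ → Fin N → ℝ) {q : ℝ}
    (hq1 : 1 < q) (hq2 : q < 2) :
    (fun c => (∑ k, |X c k| ^ q) ^ (1 / q)) ∈ closure (ellOneSeminorms X) := by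
  obtain ⟨P, W, A, hA, hP, hW, hlim⟩ := exists_integral_abs_tendsto hq1 hq2 N
  refine isClosed_closure.mem_of_tendsto (b := atTop)
    (f := fun n => fun c => ∫ ω, A⁻¹ * |∑ k, X c k * W n ω k| ∂P n) ?_ (Eventually.of_forall ?_)
  · rw [tendsto_pi_nhds]
    intro c
    simp_rw [integral_const_mul]
    have := (hlim (X c)).const_mul A⁻¹
    rwa [inv_mul_cancel_left₀ hA.ne'] at this
  · intro n
    have := hP n
    have hi : ∀ c, Integrable (fun ω => A⁻¹ * |∑ k, X c k * W n ω k|) (P n) := fun c =>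
      ((integrable_finsetSum _ fun k _ => (hW n k).const_mul _).abs).const_mul _
    have hmem := (convex_ellOneSeminorms X).closure.integral_mem isClosed_closure (μ := P n)
      (f := fun ω c => A⁻¹ * |∑ k, X c k * W n ω k|) (ae_of_all _ fun ω => subset_closure
        ⟨1, fun _ k => A⁻¹ * W n ω k, fun c => ?_⟩) (Integrable.of_eval hi)
    · convert hmem using 1
      ext c
      rw [eval_integral hi]
    · simp only [Finset.univ_unique, Finset.sum_singleton, mul_assoc, ← Finset.mul_sum, abs_mul,
        abs_of_pos (inv_pos.2 hA)]
      congr 2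
      exact Finset.sum_congr rfl fun k _ => mul_comm _ _

theorem ellNorm_mem_closure {κ : Type*} [Fintype κ] {N : ℕ} (X : κ → Fin N → ℝ) {q : ℝ}
    (hq1 : 1 < q) (hq2 : q ≤ 2) :
    (fun c => (∑ k, |X c k| ^ q) ^ (1 / q)) ∈ closure (ellOneSeminorms X) := by
  rcases hq2.lt_or_eq with h | rfl
  · exact ellNorm_mem_closure_of_lt_two X hq1 h
  · have hr : Tendsto (fun r : ℝ => r) (𝓝[<] 2) (𝓝 2) := tendsto_id.mono_left inf_le_left
    refine isClosed_closure.mem_of_tendsto (b := 𝓝[<] (2 : ℝ))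
      (f := fun r => fun c => (∑ k, |X c k| ^ r) ^ (1 / r)) ?_ ?_
    · rw [tendsto_pi_nhds]
      intro c
      refine Tendsto.rpow (tendsto_finsetSum _ fun k _ => ?_)
        (tendsto_const_nhds.div hr two_ne_zero) (Or.inr (by norm_num))
      exact tendsto_const_nhds.rpow hr (Or.inr two_pos)
    · filter_upwards [Ioo_mem_nhdsLT (one_lt_two : (1 : ℝ) < 2)] with r hr
      exact ellNorm_mem_closure_of_lt_two X hr.1 hr.2

theorem exists_finset_unit_net {V : Type*} [NormedAddCommGroup V] [NormedSpace ℝ V]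
    [FiniteDimensional ℝ V] {δ : ℝ} (hδ : 0 < δ) :
    ∃ F : Finset V, (∀ y ∈ F, ‖y‖ = 1) ∧ ∀ x : V, ‖x‖ = 1 → ∃ y ∈ F, ‖x - y‖ ≤ δ := by
  have := FiniteDimensional.proper_real V
  obtain ⟨t, hts, htf, ht⟩ := (isCompact_sphere (0 : V) 1).finite_cover_balls hδ
  refine ⟨htf.toFinset, fun y hy => by simpa using hts (htf.mem_toFinset.1 hy), fun x hx => ?_⟩
  obtain ⟨y, hy, hxy⟩ := mem_iUnion₂.1 (ht (by simpa using hx : x ∈ Metric.sphere (0 : V) 1))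
  exact ⟨y, htf.mem_toFinset.2 hy, by rw [← dist_eq_norm]; exact (Metric.mem_ball.1 hxy).le⟩

/-- Let `B` be the maximum of `s` on the unit sphere. Comparison with a `δ`-net gives `B ≤ 1 + δ + B
* δ`, so `B ≤ 2` when `δ ≤ 1 / 3`; a second comparison then gives the error `δ + 2 * δ`. -/
theorem exists_finset_forall_seminorm_near {V : Type*} [NormedAddCommGroup V] [NormedSpace ℝ V]
    [FiniteDimensional ℝ V] {δ : ℝ} (hδ : 0 < δ) (hδ1 : δ ≤ 1 / 3) :
    ∃ F : Finset V, ∀ s : Seminorm ℝ V, Continuous s → (∀ y ∈ F, |s y - ‖y‖| ≤ δ) →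
      ∀ x, (1 - 3 * δ) * ‖x‖ ≤ s x ∧ s x ≤ (1 + 3 * δ) * ‖x‖ := by
  have := FiniteDimensional.proper_real V
  obtain ⟨F, hF1, hF⟩ := exists_finset_unit_net (V := V) hδ
  refine ⟨F, fun s hs hsF => ?_⟩
  have hunit : ∀ x : V, ‖x‖ = 1 → 1 - 3 * δ ≤ s x ∧ s x ≤ 1 + 3 * δ := by
    intro x hx
    obtain ⟨x₀, hx₀, hmax⟩ := (isCompact_sphere (0 : V) 1).exists_isMaxOn
      ⟨x, by simpa using hx⟩ hs.continuousOn
    have hB : ∀ y : V, s y ≤ s x₀ * ‖y‖ := fun y => by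
      rcases eq_or_ne y 0 with rfl | hy
      · simp
      have hy' : 0 < ‖y‖ := norm_pos_iff.2 hy
      have h := hmax (show ‖y‖⁻¹ • y ∈ Metric.sphere (0 : V) 1 by
        simp [norm_smul, hy'.ne'])
      simp only [mem_ofPred_eq, map_smul_eq_mul, norm_inv, norm_norm] at h
      rwa [inv_mul_le_iff₀ hy', mul_comm] at h
    have h0 : 0 ≤ s x₀ := apply_nonneg s x₀
    have hest : ∀ x : V, ‖x‖ = 1 → 1 - δ - s x₀ * δ ≤ s x ∧ s x ≤ 1 + δ + s x₀ * δ := by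
      intro x hx
      obtain ⟨y, hy, hxy⟩ := hF x hx
      have h1 := hsF y hy
      rw [hF1 y hy, abs_le] at h1
      have h2 := abs_le.1 ((abs_sub_map_le_sub s x y).trans ((hB _).trans
        (mul_le_mul_of_nonneg_left hxy h0)))
      constructor <;> linarith
    have h3 := (hest x₀ (by simpa using hx₀)).2
    have h4 : s x₀ ≤ 2 := by nlinarith
    have h5 := hest x hx
    constructor <;> nlinarith
  intro x
  rcases eq_or_ne x 0 with rfl | hx
  · simp
  have hx' : 0 < ‖x‖ := norm_pos_iff.2 hx
  have h := hunit (‖x‖⁻¹ • x) (by simp [norm_smul, hx'.ne'])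
  rw [map_smul_eq_mul, norm_inv, norm_norm, inv_mul_eq_div, le_div_iff₀ hx', div_le_iff₀ hx'] at h
  exact h

theorem exists_near_isometry_ellOne {q : ℝ} (hq1 : 1 < q) (hq2 : q ≤ 2) (N : ℕ) {η : ℝ}
    (hη : 0 < η) :
    ∃ (M : ℕ) (a : Fin M → Fin N → ℝ), ∀ x : Fin N → ℝ,
      (1 - η) * (∑ k, |x k| ^ q) ^ (1 / q) ≤ ∑ i, |∑ k, a i k * x k| ∧
      ∑ i, |∑ k, a i k * x k| ≤ (∑ k, |x k| ^ q) ^ (1 / q) := by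
  have hqq : (ENNReal.ofReal q).toReal = q := ENNReal.toReal_ofReal (by linarith)
  have : Fact (1 ≤ ENNReal.ofReal q) := ⟨by rw [ENNReal.one_le_ofReal]; exact hq1.le⟩
  have hnorm : ∀ x : PiLp (ENNReal.ofReal q) fun _ : Fin N => ℝ,
      ‖x‖ = (∑ k, |x k| ^ q) ^ (1 / q) := fun x => by
    rw [PiLp.norm_eq_sum (by rw [hqq]; linarith), hqq]; rfl
  set δ := min (1 / 3) (η / 6) with hδ
  have hδ0 : 0 < δ := by positivity
  obtain ⟨F, hF⟩ := exists_finset_forall_seminorm_near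
    (V := PiLp (ENNReal.ofReal q) fun _ : Fin N => ℝ) hδ0 (min_le_left _ _)
  obtain ⟨z, ⟨M, a, hz⟩, hdist⟩ := Metric.mem_closure_iff.1
    (ellNorm_mem_closure (κ := F) (fun c => c.1.ofLp) hq1 hq2) δ hδ0
  let s : Seminorm ℝ (PiLp (ENNReal.ofReal q) fun _ : Fin N => ℝ) := Seminorm.of
    (fun x => ∑ i, |∑ k, a i k * x k|)
    (fun x y => by
      rw [← Finset.sum_add_distrib]
      refine Finset.sum_le_sum fun i _ => ?_
      refine le_trans (le_of_eq ?_) (abs_add_le _ _)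
      rw [← Finset.sum_add_distrib]
      simp [mul_add])
    (fun c x => by
      rw [Finset.mul_sum]
      refine Finset.sum_congr rfl fun i _ => ?_
      rw [Real.norm_eq_abs, ← abs_mul, Finset.mul_sum]
      congr 1
      refine Finset.sum_congr rfl fun k _ => ?_
      simp only [PiLp.smul_apply, smul_eq_mul]; ring)
  have hs : ∀ x : PiLp (ENNReal.ofReal q) fun _ : Fin N => ℝ,
      s x = ∑ i, |∑ k, a i k * x k| := fun x => rfl
  have hsc : Continuous s := by
    have : Continuous fun x : PiLp (ENNReal.ofReal q) fun _ : Fin N => ℝ =>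
        ∑ i, |∑ k, a i k * x k| := by fun_prop
    exact this
  have hFs := hF s hsc fun y hy => by
    have h := dist_le_pi_dist (fun c : F => (∑ k, |c.1.ofLp k| ^ q) ^ (1 / q)) z ⟨y, hy⟩
    rw [hnorm, abs_sub_comm, ← Real.dist_eq, hs]
    rw [hz] at h
    exact h.trans hdist.le
  have hp : 0 < 1 + 3 * δ := by linarith
  -- Rescaling makes the upper bound exactly `1`; the lower one becomes `(1 - 3 * δ) / (1 + 3 * δ) ≥
  -- 1 - η` since `δ ≤ η / 6`.
  refine ⟨M, fun i k => (1 + 3 * δ)⁻¹ * a i k, fun x => ?_⟩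
  have h := hFs (WithLp.toLp _ x)
  rw [hnorm, hs] at h
  simp only [mul_assoc, ← Finset.mul_sum, abs_mul, abs_of_pos (inv_pos.2 hp)]
  refine ⟨?_, ?_⟩
  · rw [le_inv_mul_iff₀ hp]
    refine le_trans ?_ h.1
    rw [← mul_assoc]
    refine mul_le_mul_of_nonneg_right ?_ (by positivity)
    have : δ ≤ η / 6 := min_le_right _ _
    nlinarith
  · rw [inv_mul_le_iff₀ hp]
    exact h.2

/-! ### From `ℓ₁`-absorption of `Y` to octahedrality of `H` -/

/-- Finite-dimensional `ℓ₁` spaces embed into `Y` isometrically and almost `ℓ₁`-orthogonally to any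
given finite set of vectors. -/
def AbsorbsEllOne (Y : Type*) [NormedAddCommGroup Y] [NormedSpace ℝ Y] : Prop :=
  ∀ (F : Finset Y) (M : ℕ) (η : ℝ), 0 < η → ∃ J : (Fin M → ℝ) →ₗ[ℝ] Y,
    (∀ v, ‖J v‖ = ∑ i, |v i|) ∧ ∀ y ∈ F, ∀ v, ‖y‖ + ∑ i, |v i| - η ≤ ‖y + J v‖

theorem hasOctahedralNorm_of_forall_norm_eq_one {X : Type*} [NormedAddCommGroup X]
    [NormedSpace ℝ X] (h : ∀ E : Submodule ℝ X, FiniteDimensional ℝ E → ∀ ε : ℝ, 0 < ε →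
      ∃ y : X, ‖y‖ = 1 ∧ ∀ x ∈ E, ‖x‖ = 1 → ∀ c : ℝ, (1 - ε) * (1 + |c|) ≤ ‖x + c • y‖) :
    HasOctahedralNorm X := by
  intro E hE ε hε
  obtain ⟨y, hy, hE⟩ := h E hE ε hε
  refine ⟨y, hy, fun x hx c => ?_⟩
  rcases eq_or_ne x 0 with rfl | hx0
  · rw [norm_zero, zero_add, zero_add, norm_smul, hy, mul_one, Real.norm_eq_abs]
    nlinarith [abs_nonneg c]
  · have hpos : 0 < ‖x‖ := norm_pos_iff.2 hx0
    have h := hE (‖x‖⁻¹ • x) (E.smul_mem _ hx)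
      (by rw [norm_smul, norm_inv, norm_norm, inv_mul_cancel₀ hpos.ne']) (‖x‖⁻¹ * c)
    rw [mul_smul, ← smul_add, norm_smul, norm_inv, norm_norm, abs_mul, abs_inv, abs_norm,
      le_inv_mul_iff₀ hpos] at h
    refine le_trans (le_of_eq ?_) h
    field_simp

theorem one_lt_and_le_two_of_holderConjugate {p q : ℝ≥0∞} [p.HolderConjugate q] (hp : 2 ≤ p)
    (hp' : p < ∞) : 1 < q ∧ q ≤ 2 := by
  have h := ENNReal.HolderConjugate.inv_add_inv_eq_one p q
  have hp1 : p⁻¹ ≤ 2⁻¹ := ENNReal.inv_le_inv.2 hp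
  have hp0 : 0 < p⁻¹ := ENNReal.inv_pos.2 hp'.ne
  constructor
  · rw [← ENNReal.inv_lt_one, ← h, add_comm]
    refine ENNReal.lt_add_right ?_ hp0.ne'
    intro hq
    rw [hq] at h
    simp at h
  · rw [← ENNReal.inv_le_inv]
    by_contra! hlt
    have : p⁻¹ + q⁻¹ < 2⁻¹ + 2⁻¹ :=
      ENNReal.add_lt_add_of_le_of_lt (hp1.trans_lt (by simp)).ne hp1 hlt
    rw [h, ENNReal.inv_two_add_inv_two] at this
    exact lt_irrefl _ this

section

variable {q : ℝ≥0∞}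

theorem exists_finite_support_lt_norm_apply [Fact (1 ≤ q)] (hq : q ≠ ∞) {Y : Type*}
    [NormedAddCommGroup Y] [NormedSpace ℝ Y] (T : EllP q →L[ℝ] Y) {r : ℝ} (hr : r < ‖T‖) :
    ∃ (n : ℕ) (x : EllP q), (∀ k, n ≤ k → x k = 0) ∧ ‖x‖ ≤ 1 ∧ r < ‖T x‖ := by
  obtain ⟨x, hx, hTx⟩ := T.exists_lt_apply_of_lt_opNorm hr
  have hlim := (lp.hasSum_single hq x).tendsto_sum_nat
  obtain ⟨n, hn, hn'⟩ := ((hlim.norm.eventually_lt_const hx).and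
    (((T.continuous.tendsto x).comp hlim).norm.eventually_const_lt hTx)).exists
  refine ⟨n, _, fun k hk => ?_, hn.le, hn'⟩
  rw [lp.coeFn_sum, Finset.sum_apply]
  refine Finset.sum_eq_zero fun i hi => ?_
  rw [lp.single_apply_ne]
  exact (lt_of_lt_of_le (Finset.mem_range.1 hi) hk).ne'

theorem ellP_norm_eq_of_finite_support (hq : 0 < q.toReal) {N : ℕ} (x : EllP q)
    (hx : ∀ k, N ≤ k → x k = 0) :
    (∑ k : Fin N, |x k| ^ q.toReal) ^ (1 / q.toReal) = ‖x‖ := by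
  rw [lp.norm_eq_tsum_rpow hq, tsum_eq_sum (s := Finset.range N), Finset.sum_range]
  · rfl
  · intro k hk
    rw [hx k (by simpa using hk), norm_zero, Real.zero_rpow hq.ne']

theorem ellP_sum_rpow_le_norm [Fact (1 ≤ q)] (hq : 0 < q.toReal) (N : ℕ) (x : EllP q) :
    (∑ k : Fin N, |x k| ^ q.toReal) ^ (1 / q.toReal) ≤ ‖x‖ := by
  have h := lp.sum_rpow_le_norm_rpow hq x (Finset.range N)
  rw [Finset.sum_range] at h
  refine (Real.rpow_le_rpow (Finset.sum_nonneg fun k _ => by positivity) h (by positivity)).trans ?_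
  rw [← Real.rpow_mul (norm_nonneg x), mul_one_div_cancel hq.ne', Real.rpow_one]

end

theorem ellPairing_single (p q : ℝ≥0∞) [Fact (1 ≤ p)] [Fact (1 ≤ q)] [p.HolderConjugate q] (k : ℕ)
    (x : EllP q) : ellPairing p q (lp.single p k 1) x = x k := by
  rw [ellPairing_apply, tsum_eq_single k]
  · simp
  · intro j hj
    rw [lp.single_apply_ne _ _ _ hj, zero_mul]

theorem hasOctahedralNorm_of_absorbsEllOne (p q : ℝ≥0∞) [Fact (1 ≤ p)] [Fact (1 ≤ q)]
    [p.HolderConjugate q] (hp : 2 ≤ p) (hp' : p < ∞) {Y : Type*} [NormedAddCommGroup Y]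
    [NormedSpace ℝ Y] (hY : AbsorbsEllOne Y) (H : Submodule ℝ (EllP q →L[ℝ] Y))
    (hH : ellTensor p q Y ≤ H) : HasOctahedralNorm H := by
  classical
  obtain ⟨hq1, hq2⟩ := one_lt_and_le_two_of_holderConjugate (q := q) hp hp'
  have hqt : q ≠ ∞ := (hq2.trans_lt (by simp)).ne
  have hr1 : 1 < q.toReal := by
    simpa using (ENNReal.toReal_lt_toReal ENNReal.one_ne_top hqt).2 hq1
  have hr2 : q.toReal ≤ 2 := by
    simpa using ENNReal.toReal_mono (by simp) hq2
  have hr0 : 0 < q.toReal := by linarith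
  refine hasOctahedralNorm_of_forall_norm_eq_one fun E hE ε hε => ?_
  -- The coefficient of `1` loses `η` three times: in the net, in the norming vector and in the
  -- absorption. The coefficient of `|c|` loses `2 * η`.
  set η := min (1 / 4) (ε / 3) with hη
  have hη0 : 0 < η := by positivity
  have hη1 : η ≤ 1 / 4 := min_le_left _ _
  have hηε : 3 * η ≤ ε := by linarith [min_le_right (1 / 4) (ε / 3)]
  obtain ⟨G, hG1, hG⟩ := exists_finset_unit_net (V := E) hη0
  have hx : ∀ T : E, T ∈ G → ∃ (n : ℕ) (x : EllP q), (∀ k, n ≤ k → x k = 0) ∧ ‖x‖ ≤ 1 ∧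
      1 - η < ‖T.1.1 x‖ := fun T hT =>
    exists_finite_support_lt_norm_apply hqt T.1.1 (by
      have : ‖T.1.1‖ = 1 := hG1 T hT
      linarith)
  choose! n x hxn hx1 hxT using hx
  -- The `+ 1` keeps the first basis vector inside the truncation, so that `S ≠ 0` even if `G` is
  -- empty.
  set N := G.sup n + 1
  obtain ⟨M, a, ha⟩ := exists_near_isometry_ellOne hr1 hr2 N hη0
  obtain ⟨J, hJ, hJF⟩ := hY (G.image fun T => T.1.1 (x T)) M η hη0
  let S : EllP q →L[ℝ] Y :=
    ∑ k : Fin N, (ellPairing p q (lp.single p (k : ℕ) 1)).smulRight (J fun i => a i k)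
  have hS : ∀ z, S z = J fun i => ∑ k : Fin N, a i k * z k := fun z => by
    simp only [S, _root_.sum_apply, ContinuousLinearMap.smulRight_apply,
      ellPairing_single, ← map_smul, ← map_sum]
    congr 1; ext i
    simp [mul_comm]
  have hSH : S ∈ H := hH (Submodule.sum_mem _ fun k _ => Submodule.subset_span ⟨_, _, rfl⟩)
  have hSle : ‖S‖ ≤ 1 := S.opNorm_le_bound zero_le_one fun z => by
    rw [hS, hJ, one_mul]
    exact (ha fun k => z k).2.trans (ellP_sum_rpow_le_norm hr0 N z)
  have hSge : ∀ z : EllP q, (∀ k, N ≤ k → z k = 0) →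
      (1 - η) * ‖z‖ ≤ ∑ i, |∑ k : Fin N, a i k * z k| := fun z hz => by
    have := (ha fun k => z k).1
    rwa [ellP_norm_eq_of_finite_support hr0 z hz] at this
  have hSpos : 0 < ‖S‖ := by
    have h := hSge (lp.single q 0 1) fun k hk => lp.single_apply_ne _ _ _ (by omega)
    rw [lp.norm_single (by exact_mod_cast hq1.trans' one_pos), norm_one, ← hJ, ← hS] at h
    have h2 := S.le_opNorm (lp.single q 0 1)
    rw [lp.norm_single (by exact_mod_cast hq1.trans' one_pos), norm_one] at h2
    linarith
  refine ⟨⟨‖S‖⁻¹ • S, H.smul_mem _ hSH⟩, ?_, ?_⟩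
  · rw [Submodule.coe_norm, norm_smul, norm_inv, norm_norm, inv_mul_cancel₀ hSpos.ne']
  · intro T hT hT1 c
    obtain ⟨T', hT', hTT'⟩ := hG ⟨T, hT⟩ hT1
    set R : H := c • ⟨‖S‖⁻¹ • S, H.smul_mem _ hSH⟩ with hR
    have h1 : ‖T'.1 + R‖ ≤ ‖T + R‖ + η := by
      have h := norm_sub_le (T + R) (T - T'.1)
      have h' : ‖T - T'.1‖ ≤ η := hTT'
      rw [show T + R - (T - T'.1) = T'.1 + R by abel] at h
      linarith
    have h2 : ‖(T'.1 + R).1 (x T')‖ ≤ ‖T'.1 + R‖ :=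
      ((T'.1 + R).1.le_opNorm _).trans (mul_le_of_le_one_right (norm_nonneg _) (hx1 T' hT'))
    set v : Fin M → ℝ := fun i => ∑ k : Fin N, a i k * x T' k
    have h3 : (T'.1 + R).1 (x T') = T'.1.1 (x T') + J ((c * ‖S‖⁻¹) • v) := by
      rw [map_smul, ← hS, mul_smul]; rfl
    have h4 := hJF _ (Finset.mem_image_of_mem (fun T => T.1.1 (x T)) hT') ((c * ‖S‖⁻¹) • v)
    rw [← h3] at h4
    have h5 : ∑ i, |((c * ‖S‖⁻¹) • v) i| = |c| * ‖S‖⁻¹ * ∑ i, |v i| := by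
      simp only [Pi.smul_apply, smul_eq_mul, abs_mul, abs_inv, abs_norm, Finset.mul_sum]
    have h6 : (1 - η) * ‖x T'‖ ≤ ∑ i, |v i| := hSge (x T') fun k hk =>
      hxn T' hT' k ((Finset.le_sup (f := n) hT').trans (by omega))
    have h7 : 1 - η ≤ ‖x T'‖ := by
      have h := T'.1.1.le_opNorm (x T')
      have h' : ‖T'.1.1‖ = 1 := hG1 T' hT'
      rw [h', one_mul] at h
      linarith [hxT T' hT']
    have h8 : 1 - 2 * η ≤ ∑ i, |v i| := by nlinarith
    have h9 : |c| * (1 - 2 * η) ≤ |c| * ‖S‖⁻¹ * ∑ i, |v i| := by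
      rw [mul_assoc]
      refine mul_le_mul_of_nonneg_left ?_ (abs_nonneg c)
      -- Since `‖S‖ ≤ 1`, normalizing `S` can only enlarge its values.
      exact h8.trans (le_mul_of_one_le_left (by linarith) ((one_le_inv₀ hSpos).2 hSle))
    have h10 := hxT T' hT'
    rw [h5] at h4
    nlinarith [abs_nonneg c]

/-! ### The targets `ℓ₁` and `L₁[0,1]` -/

theorem absorbsEllOne_of_approx {Y : Type*} [NormedAddCommGroup Y] [NormedSpace ℝ Y]
    (h : ∀ (F : Finset Y) (M : ℕ) (η : ℝ), 0 < η → ∃ J : (Fin M → ℝ) →ₗ[ℝ] Y,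
      (∀ v, ‖J v‖ = ∑ i, |v i|) ∧
      ∀ y ∈ F, ∃ u, ‖y - u‖ ≤ η ∧ ∀ v, ‖u + J v‖ = ‖u‖ + ∑ i, |v i|) : AbsorbsEllOne Y := by
  intro F M η hη
  obtain ⟨J, hJ, hF⟩ := h F M (η / 2) (by positivity)
  refine ⟨J, hJ, fun y hy v => ?_⟩
  obtain ⟨u, hu, huv⟩ := hF y hy
  have h1 := norm_sub_le (y + J v) (y - u)
  rw [show y + J v - (y - u) = u + J v by abel, huv] at h1
  have h2 := norm_add_le (y - u) u
  rw [sub_add_cancel] at h2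
  linarith

theorem ellOne_norm_sum_single (f : ℕ → ℝ) (s : Finset ℕ) :
    ‖(∑ i ∈ s, lp.single 1 i (f i) : EllP 1)‖ = ∑ i ∈ s, |f i| := by
  have h := lp.norm_sum_single (p := 1) (E := fun _ : ℕ => ℝ) (by simp) f s
  simpa using h

theorem ellOne_norm_sum_single_add (f : ℕ → ℝ) (K : ℕ) {M : ℕ} (v : Fin M → ℝ) :
    ‖(∑ i ∈ Finset.range K, lp.single 1 i (f i) + ∑ i : Fin M, lp.single 1 (K + i) (v i) :
      EllP 1)‖ = ∑ i ∈ Finset.range K, |f i| + ∑ i, |v i| := by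
  set g : ℕ → ℝ := fun k => if k < K then f k else if h : k - K < M then v ⟨k - K, h⟩ else 0
  have hg1 : ∀ i ∈ Finset.range K, g i = f i := fun i hi => if_pos (Finset.mem_range.1 hi)
  have hg2 : ∀ i : Fin M, g (K + i) = v i := fun i => by simp [g]
  have h := ellOne_norm_sum_single g (Finset.range (K + M))
  rw [Finset.sum_range_add, Finset.sum_range_add, Finset.sum_range (n := M),
    Finset.sum_range (n := M)] at h
  simp only [hg2] at h
  rw [Finset.sum_congr rfl fun i hi => by rw [hg1 i hi],
    Finset.sum_congr (f := fun i => |g i|) rfl fun i hi => by rw [hg1 i hi]] at h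
  exact h

/-- Truncate all of `F` at a common index `K` and use the next `M` unit vectors. -/
theorem absorbsEllOne_ellOne : AbsorbsEllOne (EllP 1) := by
  refine absorbsEllOne_of_approx fun F M η hη => ?_
  have hK : ∀ᶠ K in atTop, ∀ y ∈ F, ‖y - ∑ i ∈ Finset.range K, lp.single 1 i (y i)‖ ≤ η := by
    rw [Filter.eventually_all_finset]
    intro y _
    have h := ((lp.hasSum_single ENNReal.one_ne_top y).tendsto_sum_nat.const_sub y).norm
    rw [sub_self, norm_zero] at h
    exact (h.eventually_lt_const hη).mono fun _ h => h.le
  obtain ⟨K, hK⟩ := hK.exists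
  refine ⟨∑ i : Fin M, (lp.lsingle 1 (K + (i : ℕ))).comp (LinearMap.proj i), fun v => ?_,
    fun y hy => ⟨_, hK y hy, fun v => ?_⟩⟩
  · have := ellOne_norm_sum_single_add 0 K v
    simpa using this
  · rw [ellOne_norm_sum_single, ← ellOne_norm_sum_single_add]
    simp

theorem norm_add_sum_of_disjoint_support {α ι : Type*} [MeasurableSpace α] {μ : Measure α}
    {A : ι → Set α} (hA : Pairwise fun i j => Disjoint (A i) (A j)) {f : ι → Lp ℝ 1 μ}
    (hf : ∀ i, ∀ᵐ t ∂μ, t ∉ A i → f i t = 0) (s : Finset ι) (u : Lp ℝ 1 μ)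
    (hu : ∀ i ∈ s, ∀ᵐ t ∂μ, t ∈ A i → u t = 0) :
    ‖u + ∑ i ∈ s, f i‖ = ‖u‖ + ∑ i ∈ s, ‖f i‖ := by
  classical
  induction s using Finset.induction_on generalizing u with
  | empty => simp
  | insert i s hi ih =>
    rw [Finset.sum_insert hi, Finset.sum_insert hi, ← add_assoc, ih, ← add_assoc]
    · congr 1
      rw [L1.norm_eq_integral_norm, L1.norm_eq_integral_norm, L1.norm_eq_integral_norm,
        ← integral_add (L1.integrable_coeFn u).norm (L1.integrable_coeFn (f i)).norm]
      refine integral_congr_ae ?_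
      filter_upwards [Lp.coeFn_add u (f i), hf i, hu i (Finset.mem_insert_self i s)]
        with t h1 h2 h3
      rw [h1, Pi.add_apply]
      by_cases ht : t ∈ A i
      · rw [h3 ht]; simp
      · rw [h2 ht]; simp
    · intro j hj
      filter_upwards [Lp.coeFn_add u (f i), hf i, hu j (Finset.mem_insert_of_mem hj)]
        with t h1 h2 h3 ht
      have hij : i ≠ j := fun h => hi (h ▸ hj)
      rw [h1, Pi.add_apply, h3 ht, h2 (disjoint_right.1 (hA hij) ht), add_zero]

/-- By uniform integrability of the finite set `F`, all its members have small `L₁` mass on some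
`(0, d]`. Normalized indicators of `M` equal pieces of `(0, d]` span `ℓ_1^M`, and erasing `y` on
`(0, d]` makes it disjoint from them. -/
theorem absorbsEllOne_lOne : AbsorbsEllOne LOne := by
  refine absorbsEllOne_of_approx fun F M η hη => ?_
  set μ : Measure ℝ := volume.restrict (Icc (0 : ℝ) 1)
  have hδ : ∀ y ∈ F, ∃ δ : ℝ, 0 < δ ∧ ∀ s, MeasurableSet s → μ s ≤ ENNReal.ofReal δ →
      eLpNorm (s.indicator y) 1 μ ≤ ENNReal.ofReal η := fun y _ => by
    obtain ⟨δ, h0, h⟩ := (Lp.memLp y).eLpNorm_indicator_le le_rfl ENNReal.one_ne_top hη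
    exact ⟨δ, h0, h⟩
  choose! δ hδ0 hδ using hδ
  obtain ⟨d, hd0, hd1, hdF⟩ : ∃ d : ℝ, 0 < d ∧ d ≤ 1 ∧ ∀ y ∈ F, d ≤ δ y := by
    have : ∀ᶠ d in 𝓝[>] (0 : ℝ), 0 < d ∧ d ≤ 1 ∧ ∀ y ∈ F, d ≤ δ y := by
      refine eventually_mem_nhdsWithin.and (Eventually.and ?_ ?_)
      · exact eventually_nhdsWithin_of_eventually_nhds (eventually_le_nhds one_pos)
      · rw [Filter.eventually_all_finset]
        exact fun y hy => eventually_nhdsWithin_of_eventually_nhds (eventually_le_nhds (hδ0 y hy))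
    exact this.exists
  set g : ℕ → ℝ := fun n => d * (n / M)
  have hgmono : Monotone g := fun m n hmn => by
    simp only [g]; gcongr
  set A : Fin M → Set ℝ := fun i => Ioc (g i) (g (i + 1))
  have hdisj : Pairwise fun i j => Disjoint (A i) (A j) := fun i j hij =>
    hgmono.pairwise_disjoint_on_Ioc_succ (by simpa [Fin.val_inj] using hij)
  have hAsub : ∀ i, A i ⊆ Ioc 0 d := fun i => by
    have hM : (0 : ℝ) < M := by exact_mod_cast i.pos
    refine Ioc_subset_Ioc (by positivity) ?_
    have : (((i : ℕ) + 1 : ℕ) : ℝ) / M ≤ 1 := by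
      rw [div_le_one hM]; exact_mod_cast i.isLt
    simp only [g]; nlinarith
  have hsub : Ioc 0 d ⊆ Icc (0 : ℝ) 1 := fun t ht => ⟨ht.1.le, ht.2.trans hd1⟩
  have hAm : ∀ i, MeasurableSet (A i) := fun i => measurableSet_Ioc
  have hAμ : ∀ i, μ (A i) ≠ ∞ := fun i => measure_ne_top _ _
  have hApos : ∀ i, 0 < μ.real (A i) := fun i => by
    have hM : (0 : ℝ) < M := by exact_mod_cast i.pos
    have : g i < g (i + 1) := by
      simp only [g]; push_cast; gcongr; linarith
    rw [measureReal_restrict_apply (hAm i), inter_eq_left.2 ((hAsub i).trans hsub),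
      Real.volume_real_Ioc_of_le this.le]
    linarith
  set e : Fin M → LOne := fun i => indicatorConstLp 1 (hAm i) (hAμ i) (μ.real (A i))⁻¹
  have he : ∀ i, ‖e i‖ = 1 := fun i => by
    rw [norm_indicatorConstLp one_ne_zero ENNReal.one_ne_top, norm_inv,
      Real.norm_of_nonneg (hApos i).le, ENNReal.toReal_one, div_one, Real.rpow_one,
      inv_mul_cancel₀ (hApos i).ne']
  have hsupp : ∀ (v : Fin M → ℝ) i, ∀ᵐ t ∂μ, t ∉ A i → (v i • e i) t = 0 := fun v i => by
    filter_upwards [Lp.coeFn_smul (v i) (e i), indicatorConstLp_coeFn (p := 1) (hs := hAm i)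
      (hμs := hAμ i) (c := (μ.real (A i))⁻¹)] with t h1 h2 ht
    rw [h1, Pi.smul_apply, h2, indicator_of_notMem ht, smul_zero]
  have hkey : ∀ (u : LOne) (v : Fin M → ℝ), (∀ i, ∀ᵐ t ∂μ, t ∈ A i → u t = 0) →
      ‖u + ∑ i, v i • e i‖ = ‖u‖ + ∑ i, |v i| := fun u v hu => by
    rw [norm_add_sum_of_disjoint_support hdisj (hsupp v) Finset.univ u fun i _ => hu i]
    simp [norm_smul, he]
  refine ⟨Fintype.linearCombination ℝ e, fun v => ?_, fun y hy => ?_⟩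
  · have := hkey 0 v fun i => by
      filter_upwards [Lp.coeFn_zero ℝ 1 μ] with t ht _
      rw [ht]; rfl
    rw [zero_add, norm_zero, zero_add] at this
    exact this
  · have hm : MemLp ((Ioc 0 d).indicator y) 1 μ := (Lp.memLp y).indicator measurableSet_Ioc
    refine ⟨y - hm.toLp, ?_, fun v => hkey _ v fun i => ?_⟩
    · rw [sub_sub_cancel, Lp.norm_toLp]
      refine ENNReal.toReal_le_of_le_ofReal hη.le (hδ y hy _ measurableSet_Ioc ?_)
      refine (Measure.restrict_apply_le _ _).trans ?_
      rw [Real.volume_Ioc, sub_zero]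
      exact ENNReal.ofReal_le_ofReal (hdF y hy)
    · filter_upwards [Lp.coeFn_sub y hm.toLp, hm.coeFn_toLp] with t h1 h2 ht
      rw [h1, Pi.sub_apply, h2, indicator_of_mem (hAsub i ht), sub_self]

theorem mainTheorem8 (p q : ℝ≥0∞) [Fact (1 ≤ p)] [Fact (1 ≤ q)] [p.HolderConjugate q]
    (hp : 2 ≤ p) (hp' : p < ∞) :
    (∀ H : Submodule ℝ (EllP q →L[ℝ] EllP 1), IsClosed (H : Set (EllP q →L[ℝ] EllP 1)) →
      ellTensor p q (EllP 1) ≤ H → HasOctahedralNorm H) ∧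
    (∀ H : Submodule ℝ (EllP q →L[ℝ] LOne), IsClosed (H : Set (EllP q →L[ℝ] LOne)) →
      ellTensor p q LOne ≤ H → HasOctahedralNorm H) :=
  ⟨fun H _ hH => hasOctahedralNorm_of_absorbsEllOne p q hp hp' absorbsEllOne_ellOne H hH,
    fun H _ hH => hasOctahedralNorm_of_absorbsEllOne p q hp hp' absorbsEllOne_lOne H hH⟩
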